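/- Let $\operatorname{Log}$ be the principal logarithm on $\mathcal A=\mathbb C\setminus(-\infty,0]$ and put $$G(z)=\Bigl(1-\frac{\operatorname{Log} z}{\operatorname{Log}(1+z)}\Bigr)\,z\operatorname{Log} z,\qquad z\in\mathcal A.$$ Let $$\rho(t)=\begin{cases}-\dfrac{t\ln((1-t)/t^2)}{\ln(1-t)}, & 0<t<1,\\[2mm] -\dfrac{t\,(\ln((t-1)/t))^2}{(\ln(t-1))^2+\pi^2}, & t>1,\end{cases}\qquad \rho(1)=-1,$$ and $$\varphi(s)=\int_0^\infty e^{-st}\rho(t)\,dt,\qquad s\ge 0.$$ **Proposition.** The function $\varphi$ is square integrable on $[0,\infty)$. The function $t\mapsto 1-G(a+it)$ is square integrable on $\mathbb R$ for every $a\ge 0$ (for $a=0$ it is defined for $t\neq0$), and $$\lim_{a\to0^+}\int_{-\infty}^\infty|1-G(a+it)|^2\,\frac{dt}{2\pi}=\int_{-\infty}^\infty|1-G(it)|^2\,\frac{dt}{2\pi}=\int_0^\infty\varphi(s)^2\,ds.$$ Moreover, $t\mapsto 1-G(it)$ is the $L^2$-Fourier transform of $\varphi\cdot 1_{[0,\infty)}$.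 Here the $L^2$-Fourier transform is the continuous extension to $L^2(\mathbb R)$ of $f\mapsto\hat f$, $\hat f(t)=\int_{-\infty}^\infty e^{-its}f(s)\,ds$. -/

import Mathlib

open MeasureTheory Filter Topology Set
open scoped FourierTransform

noncomputable section

namespace CutPlane

/-- `G(z) = (1 - Log z / Log (1 + z)) z Log z`, with `Log` the principal logarithm. -/
def G (z : ℂ) : ℂ :=
  (1 - Complex.log z / Complex.log (1 + z)) * z * Complex.log z

/-- The density `ρ` on `(0, ∞)`; at `t = 1` it takes the common one-sided limit `-1`. -/
def rho (t : ℝ) : ℝ :=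
  if t < 1 then -(t * Real.log ((1 - t) / t ^ 2) / Real.log (1 - t))
  else if 1 < t then
    -(t * Real.log ((t - 1) / t) ^ 2 / (Real.log (t - 1) ^ 2 + Real.pi ^ 2))
  else -1

/-- `φ(s) = ∫_0^∞ e^{-st} ρ(t) dt`, used for `s ≥ 0`. -/
def phi (s : ℝ) : ℝ :=
  ∫ t in Ioi (0 : ℝ), Real.exp (-(s * t)) * rho t

/-- The function `φ · 1_{[0,∞)}` on the real line. -/
def phiPos : ℝ → ℂ :=
  indicator (Ici (0 : ℝ)) (fun s => (phi s : ℂ))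

/-- The `L²`-Fourier transform in the normalisation `f̂(t) = ∫ e^{-its} f(s) ds`. Mathlib's
`L²`-Fourier transform `𝓕` extends `ξ ↦ ∫ e^{-2πiξs} f(s) ds`, so that `f̂(t) = (𝓕 f)(t / 2π)`.
The value is an element of `L²`, so this representative is determined up to null sets. -/
def fourierL2 (f : Lp ℂ 2 (volume : Measure ℝ)) (t : ℝ) : ℂ :=
  (𝓕 f : Lp ℂ 2 (volume : Measure ℝ)) (t / (2 * Real.pi))

end CutPlane

end

/-!
Write `F = 1 - G`. It extends continuously to the closed upper half plane minus the origin, commutes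
with conjugation, is `O(|z|^{-1/4})` at `0` and `O(|z|^{-1})` at `∞`, and its boundary values on the
negative axis satisfy `Im F(-t) = -π ρ(t)`. Cauchy's formula on the cut plane, carried out in the
coordinate `ζ = log z`, where the cut plane is the strip `|Im ζ| < π`, therefore gives the
Stieltjes representation `F(z) = ∫_0^∞ ρ(t) / (z + t) dt`. A Stieltjes transform is an iterated
Laplace transform, so `F` is the Laplace transform of `φ` on `Re z > 0`. The bounds on `F` pass to
`ρ` and then to `φ`, which is thus square integrable, and Plancherel's theorem on the lines
`Re z = a`, together with `L²`-continuity of `a ↦ e^{-as} φ(s)` at `a = 0`, gives the rest.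
-/

noncomputable section

namespace CutPlane

open ComplexConjugate

section PowerWeight

/-- The two-power weight `r ↦ min (r ^ (-α)) (r ^ (-β))` on `(0, ∞)`. For `α ≤ β` it is `r ^ (-α)`
near `0` and `r ^ (-β)` near infinity; bounds with different rates at the two ends are stated with
it. -/
def powerWeight (α β r : ℝ) : ℝ := min (r ^ (-α)) (r ^ (-β))

variable {α β r a t : ℝ}

theorem powerWeight_nonneg (hr : 0 ≤ r) : 0 ≤ powerWeight α β r := by
  unfold powerWeight; positivity

theorem powerWeight_pos (hr : 0 < r) : 0 < powerWeight α β r := by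
  unfold powerWeight; positivity

theorem powerWeight_le_left : powerWeight α β r ≤ r ^ (-α) := min_le_left _ _

theorem powerWeight_le_right : powerWeight α β r ≤ r ^ (-β) := min_le_right _ _

theorem powerWeight_of_le_one (hαβ : α ≤ β) (hr : 0 < r) (hr1 : r ≤ 1) :
    powerWeight α β r = r ^ (-α) :=
  min_eq_left (Real.rpow_le_rpow_of_exponent_ge hr hr1 (neg_le_neg hαβ))

theorem powerWeight_of_one_le (hαβ : α ≤ β) (hr : 1 ≤ r) : powerWeight α β r = r ^ (-β) :=
  min_eq_right (Real.rpow_le_rpow_of_exponent_le hr (neg_le_neg hαβ))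

theorem measurable_powerWeight : Measurable (powerWeight α β) := by
  unfold powerWeight; fun_prop

theorem continuousOn_powerWeight : ContinuousOn (powerWeight α β) (Ioi 0) :=
  have continuousOn_rpow (p : ℝ) : ContinuousOn (fun r : ℝ => r ^ p) (Ioi 0) :=
    continuousOn_id.rpow_const fun _ hr => .inl (ne_of_gt hr)
  (continuousOn_rpow _).inf (continuousOn_rpow _)

theorem sq_powerWeight (hr : 0 ≤ r) :
    powerWeight α β r ^ 2 = powerWeight (2 * α) (2 * β) r := by
  have sq_rpow (p : ℝ) : (r ^ (-p)) ^ 2 = r ^ (-(2 * p)) := by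
    rw [← Real.rpow_mul_natCast hr]; ring_nf
  rw [powerWeight, powerWeight, ← sq_rpow, ← sq_rpow]
  exact (pow_left_monotoneOn (n := 2)).map_min (Real.rpow_nonneg hr _) (Real.rpow_nonneg hr _)

theorem powerWeight_div_add_le (ha : 0 < a) (ht : 0 < t) :
    powerWeight α β t / (a + t) ≤ max a⁻¹ 1 * powerWeight α (β + 1) t := by
  rw [powerWeight, powerWeight, mul_min_of_nonneg _ _ (by positivity)]
  refine le_min ?_ ?_
  · calc min (t ^ (-α)) (t ^ (-β)) / (a + t) ≤ t ^ (-α) / a := by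
          gcongr
          · exact min_le_left _ _
          · linarith
      _ = a⁻¹ * t ^ (-α) := by ring
      _ ≤ max a⁻¹ 1 * t ^ (-α) := by gcongr; exact le_max_left _ _
  · calc min (t ^ (-α)) (t ^ (-β)) / (a + t) ≤ t ^ (-β) / t := by
          gcongr
          · exact min_le_right _ _
          · linarith
      _ = 1 * t ^ (-(β + 1)) := by rw [neg_add, ← sub_eq_add_neg, Real.rpow_sub_one ht.ne', one_mul]
      _ ≤ max a⁻¹ 1 * t ^ (-(β + 1)) := by gcongr; exact le_max_right _ _

theorem integrableOn_powerWeight (hα : α < 1) (hβ : 1 < β) :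
    IntegrableOn (powerWeight α β) (Ioi 0) := by
  rw [← Ioc_union_Ioi_eq_Ioi zero_le_one]
  refine IntegrableOn.union ?_ ?_
  · have h : IntegrableOn (fun t : ℝ => t ^ (-α)) (Ioc 0 1) :=
      (intervalIntegrable_iff_integrableOn_Ioc_of_le zero_le_one).1
        (intervalIntegral.intervalIntegrable_rpow' (by linarith))
    refine h.mono' measurable_powerWeight.aestronglyMeasurable ?_
    filter_upwards [ae_restrict_mem measurableSet_Ioc] with t ht
    rw [Real.norm_of_nonneg (powerWeight_nonneg ht.1.le)]
    exact powerWeight_le_left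
  · have h : IntegrableOn (fun t : ℝ => t ^ (-β)) (Ioi 1) :=
      integrableOn_Ioi_rpow_of_lt (by linarith) one_pos
    refine h.mono' measurable_powerWeight.aestronglyMeasurable ?_
    filter_upwards [ae_restrict_mem measurableSet_Ioi] with t ht
    rw [Real.norm_of_nonneg (powerWeight_nonneg (zero_le_one.trans (le_of_lt ht)))]
    exact powerWeight_le_right

theorem integrableOn_powerWeight_div_add (hα : α < 1) (hβ : 0 < β) (ha : 0 < a) :
    IntegrableOn (fun t => powerWeight α β t / (a + t)) (Ioi 0) := by
  refine ((integrableOn_powerWeight (β := β + 1) hα (by linarith)).const_mul (max a⁻¹ 1)).mono'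
    (measurable_powerWeight.div (measurable_const_add a)).aestronglyMeasurable ?_
  filter_upwards [ae_restrict_mem measurableSet_Ioi] with t ht
  have ht0 : 0 < t := ht
  rw [Real.norm_of_nonneg (div_nonneg (powerWeight_nonneg ht0.le) (by positivity))]
  exact powerWeight_div_add_le ha ht0

theorem memLp_two_powerWeight (hα : α < 1 / 2) (hβ : 1 / 2 < β) :
    MemLp (powerWeight α β) 2 (volume.restrict (Ioi 0)) := by
  refine (memLp_two_iff_integrable_sq measurable_powerWeight.aestronglyMeasurable).2 ?_
  refine IntegrableOn.congr_fun (f := powerWeight (2 * α) (2 * β))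
    (integrableOn_powerWeight (by linarith) (by linarith)) ?_ measurableSet_Ioi
  exact fun r hr => (sq_powerWeight (le_of_lt hr)).symm

theorem exists_norm_le_mul_powerWeight {E F : Type*} [NormedAddCommGroup E] [ProperSpace E]
    [SeminormedAddCommGroup F] {f : E → F} {S : Set E} (hαβ : α ≤ β) (hS : IsClosed S)
    (hf : ContinuousOn f (S \ {0})) (hzero : f =O[𝓝[S \ {0}] 0] fun x => ‖x‖ ^ (-α))
    (hinfty : f =O[Bornology.cobounded E ⊓ 𝓟 S] fun x => ‖x‖ ^ (-β)) :
    ∃ C, 0 ≤ C ∧ ∀ x ∈ S, x ≠ 0 → ‖f x‖ ≤ C * powerWeight α β ‖x‖ := by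
  obtain ⟨A, hA⟩ := hzero.bound
  obtain ⟨B, hB⟩ := hinfty.bound
  obtain ⟨ε, hε, hA⟩ := Metric.mem_nhdsWithin_iff.1 hA
  rw [eventually_inf_principal, ← comap_norm_atTop, eventually_comap] at hB
  obtain ⟨R, hB⟩ := eventually_atTop.1 hB
  set K := {x ∈ S | min ε 1 ≤ ‖x‖} ∩ Metric.closedBall 0 (max R 1)
  have hK : IsCompact K := (isCompact_closedBall _ _).inter_left
    (hS.inter (isClosed_le continuous_const continuous_norm))
  have hK0 : ∀ x ∈ K, 0 < ‖x‖ := fun x hx => (lt_min hε one_pos).trans_le hx.1.2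
  have hcont : ContinuousOn (fun x => ‖f x‖ / powerWeight α β ‖x‖) K :=
    (hf.mono fun x hx => ⟨hx.1.1, norm_pos_iff.1 (hK0 x hx)⟩).norm.div
      (continuousOn_powerWeight.comp continuous_norm.continuousOn hK0)
      fun x hx => (powerWeight_pos (hK0 x hx)).ne'
  obtain ⟨M, hM⟩ := hK.exists_bound_of_continuousOn hcont
  refine ⟨max (max A B) (max M 0), by positivity, fun x hxS hx => ?_⟩
  have hx0 : 0 < ‖x‖ := norm_pos_iff.2 hx
  suffices ∃ D ∈ ({A, B, M} : Set ℝ), ‖f x‖ ≤ D * powerWeight α β ‖x‖ by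
    obtain ⟨D, hD, hle⟩ := this
    refine hle.trans (mul_le_mul_of_nonneg_right ?_ (powerWeight_nonneg hx0.le))
    rcases hD with rfl | rfl | rfl <;> simp
  rcases lt_or_ge ‖x‖ (min ε 1) with hsmall | hsmall
  · obtain ⟨hxε, hx1⟩ := lt_min_iff.1 hsmall
    refine ⟨A, by simp, ?_⟩
    rw [powerWeight_of_le_one hαβ hx0 hx1.le]
    simpa [abs_of_nonneg (Real.rpow_nonneg hx0.le _)] using hA ⟨by simpa using hxε, hxS, hx⟩
  rcases le_or_gt ‖x‖ (max R 1) with hlarge | hlarge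
  · refine ⟨M, by simp, (div_le_iff₀ (powerWeight_pos hx0)).1 ?_⟩
    exact (le_abs_self _).trans (hM x ⟨⟨hxS, hsmall⟩, by simpa using hlarge⟩)
  · obtain ⟨hxR, hx1⟩ := max_lt_iff.1 hlarge
    refine ⟨B, by simp, ?_⟩
    rw [powerWeight_of_one_le hαβ hx1.le]
    simpa [abs_of_nonneg (Real.rpow_nonneg hx0.le _)] using hB _ hxR.le x rfl hxS

end PowerWeight

section Strip

variable {E : Type*} [NormedAddCommGroup E] [NormedSpace ℂ E] {f : ℂ → E} {ζ ζ₀ : ℂ}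

theorem tendsto_intervalIntegral_add_mul_I [CompleteSpace E] {l : Filter ℝ}
    [l.IsCountablyGenerated] {a b : ℝ} {c : E}
    (hf : ContinuousOn f (Complex.im ⁻¹' uIcc a b))
    (hlim : Tendsto f (comap Complex.re l ⊓ 𝓟 (Complex.im ⁻¹' uIcc a b)) (𝓝 c)) :
    Tendsto (fun x : ℝ => ∫ y in a..b, f (x + y * Complex.I)) l (𝓝 ((b - a) • c)) := by
  rw [← intervalIntegral.integral_const]
  have him (x : ℝ) {y : ℝ} (hy : y ∈ uIcc a b) :
      (x + y * Complex.I : ℂ) ∈ Complex.im ⁻¹' uIcc a b := by simpa using hy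
  have hbound := (hlim.norm.eventually_le_const (lt_add_one _))
  rw [eventually_inf_principal, eventually_comap] at hbound
  refine intervalIntegral.tendsto_integral_filter_of_dominated_convergence
    (fun _ => ‖c‖ + 1) (.of_forall fun x => ?_) ?_ (by simp) (.of_forall fun y hy => ?_)
  · exact ((hf.comp (by fun_prop) fun y hy => him x hy).mono uIoc_subset_uIcc).aestronglyMeasurable
      measurableSet_uIoc
  · filter_upwards [hbound] with x hx
    exact .of_forall fun y hy => hx _ (by simp) (him x (uIoc_subset_uIcc hy))
  · refine hlim.comp (tendsto_inf.2 ⟨tendsto_comap_iff.2 ?_, tendsto_principal.2 ?_⟩)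
    · exact tendsto_id.congr fun x => by simp
    · exact .of_forall fun x => him x (uIoc_subset_uIcc hy)

theorem exp_ne_exp_of_mem_strip (hζ : ζ.im ∈ Icc (-Real.pi) Real.pi)
    (hζ₀ : ζ₀.im ∈ Ioo (-Real.pi) Real.pi) (hne : ζ ≠ ζ₀) : Complex.exp ζ ≠ Complex.exp ζ₀ := by
  intro hexp
  obtain ⟨n, hn⟩ := Complex.exp_eq_exp_iff_exists_int.1 hexp
  have him : ζ.im - ζ₀.im = n * (2 * Real.pi) := by simp [hn]
  obtain ⟨h1, h2⟩ := hζ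
  obtain ⟨h3, h4⟩ := hζ₀
  have hlt : n < 1 := by exact_mod_cast (by nlinarith [Real.pi_pos] : (n : ℝ) < 1)
  have hgt : -1 < n := by exact_mod_cast (by nlinarith [Real.pi_pos] : (-1 : ℝ) < n)
  exact hne (by simp [hn, show n = 0 by lia])

theorem dslope_exp_ne_zero (hζ : ζ.im ∈ Icc (-Real.pi) Real.pi)
    (hζ₀ : ζ₀.im ∈ Ioo (-Real.pi) Real.pi) : dslope Complex.exp ζ₀ ζ ≠ 0 := by
  rcases eq_or_ne ζ ζ₀ with rfl | hne
  · simp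
  · rw [dslope_of_ne _ hne, slope_def_field]
    exact div_ne_zero (sub_ne_zero.2 (exp_ne_exp_of_mem_strip hζ hζ₀ hne)) (sub_ne_zero.2 hne)

theorem closure_strip :
    closure (Complex.im ⁻¹' Ioo (-Real.pi) Real.pi) = Complex.im ⁻¹' Icc (-Real.pi) Real.pi := by
  rw [Complex.closure_preimage_im, closure_Ioo (by linarith [Real.pi_pos])]

theorem diffContOnCl_dslope [CompleteSpace E] {s : Set ℂ} {c : ℂ} (hf : DiffContOnCl ℂ f s)
    (hs : s ∈ 𝓝 c) : DiffContOnCl ℂ (dslope f c) s where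
  differentiableOn := (Complex.differentiableOn_dslope hs).2 hf.differentiableOn
  continuousOn := (continuousOn_dslope (mem_of_superset hs subset_closure)).2
    ⟨hf.continuousOn, hf.differentiableOn.differentiableAt hs⟩

/-- Cauchy's kernel in logarithmic coordinates with the singularity at `ζ₀` removed: off `ζ₀` it is
`(exp ζ / (exp ζ - exp ζ₀)) • (f ζ - f ζ₀)`. -/
def stripKernel (f : ℂ → E) (ζ₀ ζ : ℂ) : E :=
  (Complex.exp ζ / dslope Complex.exp ζ₀ ζ) • dslope f ζ₀ ζ

theorem stripKernel_of_ne (h : ζ ≠ ζ₀) :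
    stripKernel f ζ₀ ζ =
      (Complex.exp ζ / (Complex.exp ζ - Complex.exp ζ₀)) • (f ζ - f ζ₀) := by
  rw [stripKernel, dslope_of_ne _ h, dslope_of_ne _ h, slope_def_field, slope_def_module, smul_smul]
  congr 1
  have := sub_ne_zero.2 h
  field_simp

theorem diffContOnCl_stripKernel [CompleteSpace E]
    (hf : DiffContOnCl ℂ f (Complex.im ⁻¹' Ioo (-Real.pi) Real.pi))
    (hζ₀ : ζ₀.im ∈ Ioo (-Real.pi) Real.pi) :
    DiffContOnCl ℂ (stripKernel f ζ₀) (Complex.im ⁻¹' Ioo (-Real.pi) Real.pi) := by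
  have hnhds : Complex.im ⁻¹' Ioo (-Real.pi) Real.pi ∈ 𝓝 ζ₀ :=
    Complex.continuous_im.continuousAt.preimage_mem_nhds (isOpen_Ioo.mem_nhds hζ₀)
  have hexp : DiffContOnCl ℂ Complex.exp (Complex.im ⁻¹' Ioo (-Real.pi) Real.pi) :=
    Complex.differentiable_exp.diffContOnCl
  have hden := DiffContOnCl.inv (diffContOnCl_dslope hexp hnhds) fun ζ hζ =>
    dslope_exp_ne_zero (closure_strip ▸ hζ : ζ ∈ Complex.im ⁻¹' Icc (-Real.pi) Real.pi) hζ₀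
  exact (hexp.smul hden).smul (diffContOnCl_dslope hf hnhds)

theorem tendsto_stripKernel_atTop {l : Filter ℂ} (hl : Tendsto Complex.re l atTop)
    (hf : Tendsto f l (𝓝 0)) : Tendsto (stripKernel f ζ₀) l (𝓝 (-f ζ₀)) := by
  have hexp : Tendsto Complex.exp l (Bornology.cobounded ℂ) :=
    Complex.tendsto_exp_comap_re_atTop.mono_left hl.le_comap
  have hker : Tendsto (fun ζ => Complex.exp ζ / (Complex.exp ζ - Complex.exp ζ₀)) l (𝓝 1) := by
    have h := ((tendsto_inv₀_cobounded.comp hexp).const_mul (Complex.exp ζ₀)).const_sub 1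
    have h' := h.inv₀ (by simp)
    simp only [mul_zero, sub_zero, inv_one] at h'
    refine h'.congr fun ζ => ?_
    have := Complex.exp_ne_zero ζ
    simp only [Function.comp_apply]
    rw [← one_div, ← mul_div_mul_left _ _ this]
    field_simp
  have hlim := hker.smul (hf.sub_const (f ζ₀))
  rw [zero_sub, one_smul] at hlim
  refine hlim.congr' ?_
  filter_upwards [hl.eventually_gt_atTop ζ₀.re] with ζ hζ
  exact (stripKernel_of_ne (by rintro rfl; exact hζ.false)).symm

theorem tendsto_stripKernel_atBot {l : Filter ℂ} (hl : Tendsto Complex.re l atBot)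
    (hf : Tendsto (fun ζ => Complex.exp ζ • f ζ) l (𝓝 0)) :
    Tendsto (stripKernel f ζ₀) l (𝓝 0) := by
  have hexp : Tendsto Complex.exp l (𝓝 0) :=
    Complex.tendsto_exp_comap_re_atBot.mono_left hl.le_comap
  have hinv : Tendsto (fun ζ => (Complex.exp ζ - Complex.exp ζ₀)⁻¹) l
      (𝓝 (0 - Complex.exp ζ₀)⁻¹) :=
    (hexp.sub_const _).inv₀ (by simp)
  have hlim := hinv.smul (hf.sub (hexp.smul_const (f ζ₀)))
  rw [zero_smul, sub_zero, smul_zero] at hlim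
  refine hlim.congr' ?_
  filter_upwards [hl.eventually_lt_atBot ζ₀.re] with ζ hζ
  rw [stripKernel_of_ne (by rintro rfl; exact hζ.false), ← smul_sub, smul_smul, div_eq_inv_mul]

theorem exp_add_pi_mul_I (x : ℝ) :
    Complex.exp (x + Real.pi * Complex.I) = -Complex.exp x := by
  rw [Complex.exp_add, Complex.exp_pi_mul_I, mul_neg_one]

theorem exp_add_neg_pi_mul_I (x : ℝ) :
    Complex.exp (x + (-Real.pi : ℝ) * Complex.I) = -Complex.exp x := by
  rw [← exp_add_pi_mul_I, Complex.exp_eq_exp_iff_exists_int]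
  exact ⟨-1, by push_cast; ring⟩

theorem integral_strip_jump_add_vertical [CompleteSpace E]
    (hf : DiffContOnCl ℂ f (Complex.im ⁻¹' Ioo (-Real.pi) Real.pi))
    (hζ₀ : ζ₀.im ∈ Ioo (-Real.pi) Real.pi) (R : ℝ) :
    (∫ x in (-R)..R, (Complex.exp x / (Complex.exp ζ₀ + Complex.exp x)) •
        (f (x + (-Real.pi : ℝ) * Complex.I) - f (x + Real.pi * Complex.I))) +
      Complex.I • (∫ y in (-Real.pi)..Real.pi, stripKernel f ζ₀ (R + y * Complex.I)) -
      Complex.I • (∫ y in (-Real.pi)..Real.pi,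
        stripKernel f ζ₀ ((-R : ℝ) + y * Complex.I)) = 0 := by
  have hker := diffContOnCl_stripKernel hf hζ₀
  have hcont := closure_strip ▸ hker.continuousOn
  have hpi : -Real.pi ≤ Real.pi := by linarith [Real.pi_pos]
  have hcauchy := Complex.integral_boundary_rect_eq_zero_of_continuousOn_of_differentiableOn
    (stripKernel f ζ₀) ⟨-R, -Real.pi⟩ ⟨R, Real.pi⟩
    (hcont.mono fun ζ hζ => by simpa [uIcc_of_le hpi] using hζ.2)
    (hker.differentiableOn.mono fun ζ hζ => by simpa [hpi] using hζ.2)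
  have hint {b : ℝ} (hb : b ∈ Icc (-Real.pi) Real.pi) :
      IntervalIntegrable (fun x : ℝ => stripKernel f ζ₀ (x + b * Complex.I)) volume (-R) R :=
    (hcont.comp_continuous (by fun_prop) fun x => by simpa using hb).intervalIntegrable _ _
  have hne {b : ℝ} (hb : b ∉ Ioo (-Real.pi) Real.pi) (x : ℝ) : (x + b * Complex.I : ℂ) ≠ ζ₀ := by
    rintro rfl
    simp [hb] at hζ₀
  rw [← intervalIntegral.integral_sub (hint (left_mem_Icc.2 hpi)) (hint (right_mem_Icc.2 hpi))]
    at hcauchy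
  rw [← hcauchy]
  congr 2
  refine intervalIntegral.integral_congr fun x _ => ?_
  rw [stripKernel_of_ne (hne (by simp) x), stripKernel_of_ne (hne (by simp) x), exp_add_pi_mul_I,
    exp_add_neg_pi_mul_I, ← smul_sub, sub_sub_sub_cancel_right, ← neg_add', neg_div_neg_eq,
    add_comm (Complex.exp ζ₀)]

theorem tendsto_integral_strip_jump [CompleteSpace E]
    (hf : DiffContOnCl ℂ f (Complex.im ⁻¹' Ioo (-Real.pi) Real.pi))
    (htop : Tendsto f (comap Complex.re atTop ⊓ 𝓟 (Complex.im ⁻¹' Icc (-Real.pi) Real.pi)) (𝓝 0))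
    (hbot : Tendsto (fun ζ => Complex.exp ζ • f ζ)
      (comap Complex.re atBot ⊓ 𝓟 (Complex.im ⁻¹' Icc (-Real.pi) Real.pi)) (𝓝 0))
    (hζ₀ : ζ₀.im ∈ Ioo (-Real.pi) Real.pi) :
    Tendsto (fun R : ℝ => ∫ x in (-R)..R, (Complex.exp x / (Complex.exp ζ₀ + Complex.exp x)) •
        (f (x + (-Real.pi : ℝ) * Complex.I) - f (x + Real.pi * Complex.I)))
      atTop (𝓝 ((2 * Real.pi * Complex.I) • f ζ₀)) := by
  have hcont := closure_strip ▸ (diffContOnCl_stripKernel hf hζ₀).continuousOn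
  rw [← uIcc_of_le (by linarith [Real.pi_pos])] at hcont htop hbot
  have hright := tendsto_intervalIntegral_add_mul_I hcont
    (tendsto_stripKernel_atTop (tendsto_comap.mono_left inf_le_left) htop)
  have hleft := (tendsto_intervalIntegral_add_mul_I hcont
    (tendsto_stripKernel_atBot (tendsto_comap.mono_left inf_le_left) hbot)).comp
      tendsto_neg_atTop_atBot
  have hlim := (hleft.const_smul Complex.I).sub (hright.const_smul Complex.I)
  have hvalue : Complex.I • (Real.pi - -Real.pi) • (0 : E) -
      Complex.I • (Real.pi - -Real.pi) • -f ζ₀ = (2 * Real.pi * Complex.I) • f ζ₀ := by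
    rw [← Complex.coe_smul (Real.pi - -Real.pi) (-f ζ₀)]
    push_cast
    module
  exact hvalue ▸ hlim.congr fun R =>
    (eq_sub_of_add_eq (sub_eq_zero.1 (integral_strip_jump_add_vertical hf hζ₀ R))).symm

end Strip

section Stieltjes

theorem exp_mem_slitPlane_of_im_mem_Ioo {ζ : ℂ} (hζ : ζ.im ∈ Ioo (-Real.pi) Real.pi) :
    Complex.exp ζ ∈ Complex.slitPlane := by
  refine Complex.mem_slitPlane_iff_arg.2 ⟨?_, Complex.exp_ne_zero ζ⟩
  rw [← Complex.log_im, Complex.log_exp hζ.1 hζ.2.le]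
  exact hζ.2.ne

theorem exp_im_nonneg {ζ : ℂ} (hζ : ζ.im ∈ Icc 0 Real.pi) : 0 ≤ (Complex.exp ζ).im := by
  rw [Complex.exp_im]
  exact mul_nonneg (Real.exp_pos _).le (Real.sin_nonneg_of_nonneg_of_le_pi hζ.1 hζ.2)

theorem integrable_exp_smul_comp_exp_iff {E : Type*} [NormedAddCommGroup E] [NormedSpace ℝ E]
    {g : ℝ → E} :
    Integrable (fun x => Real.exp x • g (Real.exp x)) ↔ IntegrableOn g (Ioi 0) := by
  have h := integrableOn_image_iff_integrableOn_abs_deriv_smul MeasurableSet.univ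
    (fun x _ => (Real.hasDerivAt_exp x).hasDerivWithinAt) Real.exp_injective.injOn g
  simpa only [image_univ, Real.range_exp, integrableOn_univ, Real.abs_exp] using h.symm

theorem integral_exp_smul_comp_exp {E : Type*} [NormedAddCommGroup E] [NormedSpace ℝ E]
    (g : ℝ → E) : ∫ x, Real.exp x • g (Real.exp x) = ∫ t in Ioi 0, g t := by
  have h := integral_image_eq_integral_abs_deriv_smul MeasurableSet.univ
    (fun x _ => (Real.hasDerivAt_exp x).hasDerivWithinAt) Real.exp_injective.injOn g
  simpa only [image_univ, Real.range_exp, Measure.restrict_univ, Real.abs_exp] using h.symm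

/-- For `F` with `F (conj z) = conj (F z)`, the function `F ∘ exp` on the strip `|Im ζ| ≤ π`. The
two boundary lines receive the limits of `F` at the negative axis from above and from below; `F`
itself takes the limit from above. -/
def stripLift (F : ℂ → ℂ) (ζ : ℂ) : ℂ :=
  if 0 ≤ ζ.im then F (Complex.exp ζ) else conj (F (Complex.exp (conj ζ)))

variable {F : ℂ → ℂ} {z ζ : ℂ}

theorem stripLift_of_im_mem_Ioo (hconj : ∀ z ∈ Complex.slitPlane, F (conj z) = conj (F z))
    (hζ : ζ.im ∈ Ioo (-Real.pi) Real.pi) : stripLift F ζ = F (Complex.exp ζ) := by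
  unfold stripLift
  split_ifs
  · rfl
  · rw [Complex.exp_conj, hconj _ (exp_mem_slitPlane_of_im_mem_Ioo hζ), Complex.conj_conj]

theorem stripLift_of_im_nonpos (hconj : ∀ z ∈ Complex.slitPlane, F (conj z) = conj (F z))
    (hζ : ζ.im ≤ 0) : stripLift F ζ = conj (F (Complex.exp (conj ζ))) := by
  rcases hζ.lt_or_eq with hlt | hzero
  · exact if_neg hlt.not_ge
  · have hmem : ζ.im ∈ Ioo (-Real.pi) Real.pi := by simp [hzero, Real.pi_pos]
    rw [stripLift_of_im_mem_Ioo hconj hmem, Complex.exp_conj,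
      hconj _ (exp_mem_slitPlane_of_im_mem_Ioo hmem), Complex.conj_conj]

theorem continuousOn_stripLift (hcont : ContinuousOn F ({z | 0 ≤ z.im} \ {0}))
    (hconj : ∀ z ∈ Complex.slitPlane, F (conj z) = conj (F z)) :
    ContinuousOn (stripLift F) (Complex.im ⁻¹' Icc (-Real.pi) Real.pi) := by
  have hupper : ContinuousOn (fun ζ => F (Complex.exp ζ)) (Complex.im ⁻¹' Icc 0 Real.pi) :=
    hcont.comp Complex.continuous_exp.continuousOn
      fun ζ hζ => ⟨exp_im_nonneg hζ, Complex.exp_ne_zero ζ⟩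
  have hlower : ContinuousOn (fun ζ => conj (F (Complex.exp (conj ζ))))
      (Complex.im ⁻¹' Icc (-Real.pi) 0) :=
    Complex.continuous_conj.comp_continuousOn
      (hupper.comp Complex.continuous_conj.continuousOn fun ζ hζ => by
        simpa [neg_le, and_comm] using hζ)
  rw [← Icc_union_Icc_eq_Icc (b := (0 : ℝ)) (by simp [Real.pi_pos.le]) Real.pi_pos.le,
    preimage_union]
  exact (hlower.congr fun _ hζ => stripLift_of_im_nonpos hconj hζ.2).union_of_isClosed
    (hupper.congr fun _ hζ => if_pos hζ.1)
    (isClosed_Icc.preimage Complex.continuous_im) (isClosed_Icc.preimage Complex.continuous_im)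

theorem diffContOnCl_stripLift (hcont : ContinuousOn F ({z | 0 ≤ z.im} \ {0}))
    (hdiff : DifferentiableOn ℂ F Complex.slitPlane)
    (hconj : ∀ z ∈ Complex.slitPlane, F (conj z) = conj (F z)) :
    DiffContOnCl ℂ (stripLift F) (Complex.im ⁻¹' Ioo (-Real.pi) Real.pi) where
  differentiableOn :=
    (hdiff.comp Complex.differentiable_exp.differentiableOn fun _ hζ =>
      exp_mem_slitPlane_of_im_mem_Ioo hζ).congr fun _ hζ => stripLift_of_im_mem_Ioo hconj hζ
  continuousOn := closure_strip ▸ continuousOn_stripLift hcont hconj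

theorem norm_stripLift : ‖stripLift F ζ‖ = ‖F (Complex.exp (ζ.re + |ζ.im| * Complex.I))‖ := by
  unfold stripLift
  split_ifs with h
  · rw [abs_of_nonneg h, Complex.re_add_im]
  · rw [Complex.norm_conj, abs_of_neg (not_le.1 h)]
    congr 3
    apply Complex.ext <;> simp

theorem tendsto_stripLift_atTop
    (hinfty : Tendsto F (Bornology.cobounded ℂ ⊓ 𝓟 {z | 0 ≤ z.im}) (𝓝 0)) :
    Tendsto (stripLift F)
      (comap Complex.re atTop ⊓ 𝓟 (Complex.im ⁻¹' Icc (-Real.pi) Real.pi)) (𝓝 0) := by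
  refine tendsto_zero_iff_norm_tendsto_zero.2 ((tendsto_zero_iff_norm_tendsto_zero.1
    (hinfty.comp (tendsto_inf.2 ⟨?_, tendsto_principal.2 ?_⟩))).congr fun ζ => norm_stripLift.symm)
  · refine (Complex.tendsto_exp_comap_re_atTop.comp (tendsto_comap_iff.2 ?_)).mono_left inf_le_left
    exact tendsto_comap.congr fun ζ => by simp
  · exact eventually_inf_principal.2 <| .of_forall fun ζ hζ =>
      exp_im_nonneg (by simpa [abs_le] using hζ)

theorem tendsto_exp_smul_stripLift_atBot
    (hzero : Tendsto (fun z => z * F z) (𝓝[{z | 0 ≤ z.im} \ {0}] 0) (𝓝 0)) :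
    Tendsto (fun ζ => Complex.exp ζ • stripLift F ζ)
      (comap Complex.re atBot ⊓ 𝓟 (Complex.im ⁻¹' Icc (-Real.pi) Real.pi)) (𝓝 0) := by
  have hfold : Tendsto (fun ζ : ℂ => Complex.exp (ζ.re + |ζ.im| * Complex.I))
      (comap Complex.re atBot ⊓ 𝓟 (Complex.im ⁻¹' Icc (-Real.pi) Real.pi))
      (𝓝[{z | 0 ≤ z.im} \ {0}] 0) := by
    refine tendsto_nhdsWithin_iff.2 ⟨?_, eventually_inf_principal.2 <| .of_forall fun ζ hζ =>
      ⟨exp_im_nonneg (by simpa [abs_le] using hζ), Complex.exp_ne_zero _⟩⟩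
    refine (Complex.tendsto_exp_comap_re_atBot.comp (tendsto_comap_iff.2 ?_)).mono_left inf_le_left
    exact tendsto_comap.congr fun ζ => by simp
  refine tendsto_zero_iff_norm_tendsto_zero.2
    ((tendsto_zero_iff_norm_tendsto_zero.1 (hzero.comp hfold)).congr fun ζ => ?_)
  simp [norm_stripLift, Complex.norm_exp]

theorem stripLift_jump (x : ℝ) :
    stripLift F (x + (-Real.pi : ℝ) * Complex.I) - stripLift F (x + Real.pi * Complex.I) =
      -(2 * Complex.I) * (F (-(Real.exp x : ℝ))).im := by
  have hlower : stripLift F (x + (-Real.pi : ℝ) * Complex.I) = conj (F (-(Real.exp x : ℝ))) := by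
    rw [stripLift, if_neg (by simpa using Real.pi_pos), Complex.ofReal_exp, ← exp_add_pi_mul_I]
    simp
  have hupper : stripLift F (x + Real.pi * Complex.I) = F (-(Real.exp x : ℝ)) := by
    rw [stripLift, if_pos (by simpa using Real.pi_pos.le), exp_add_pi_mul_I, Complex.ofReal_exp]
  rw [hlower, hupper, ← neg_sub, Complex.sub_conj]
  push_cast
  ring

theorem eq_integral_im_neg_div_add (hcont : ContinuousOn F ({z | 0 ≤ z.im} \ {0}))
    (hdiff : DifferentiableOn ℂ F Complex.slitPlane)
    (hconj : ∀ z ∈ Complex.slitPlane, F (conj z) = conj (F z))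
    (hzero : Tendsto (fun z => z * F z) (𝓝[{z | 0 ≤ z.im} \ {0}] 0) (𝓝 0))
    (hinfty : Tendsto F (Bornology.cobounded ℂ ⊓ 𝓟 {z | 0 ≤ z.im}) (𝓝 0))
    (hz : z ∈ Complex.slitPlane)
    (hint : IntegrableOn (fun t : ℝ => ((F (-t)).im : ℂ) / (z + t)) (Ioi 0)) :
    F z = -(Real.pi : ℂ)⁻¹ * ∫ t in Ioi (0 : ℝ), ((F (-t)).im : ℂ) / (z + t) := by
  obtain ⟨hargz, hz0⟩ := Complex.mem_slitPlane_iff_arg.1 hz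
  have hlog : (Complex.log z).im ∈ Ioo (-Real.pi) Real.pi :=
    ⟨Complex.neg_pi_lt_log_im z, (Complex.log_im_le_pi z).lt_of_ne (by rwa [Complex.log_im])⟩
  have hstrip := tendsto_integral_strip_jump (diffContOnCl_stripLift hcont hdiff hconj)
    (tendsto_stripLift_atTop hinfty) (tendsto_exp_smul_stripLift_atBot hzero) hlog
  rw [stripLift_of_im_mem_Ioo hconj hlog, Complex.exp_log hz0] at hstrip
  have hline := (intervalIntegral_tendsto_integral (integrable_exp_smul_comp_exp_iff.2 hint)
    tendsto_neg_atTop_atBot tendsto_id).const_mul (-(2 * Complex.I))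
  rw [integral_exp_smul_comp_exp fun t : ℝ => ((F (-t)).im : ℂ) / (z + t)] at hline
  have heq : -(2 * Complex.I) * ∫ t in Ioi (0 : ℝ), ((F (-t)).im : ℂ) / (z + t) =
      (2 * Real.pi * Complex.I) • F z := by
    refine tendsto_nhds_unique hline (hstrip.congr fun R => ?_)
    rw [← intervalIntegral.integral_const_mul]
    refine intervalIntegral.integral_congr fun x _ => ?_
    simp only [stripLift_jump, smul_eq_mul, Complex.real_smul, Complex.ofReal_exp]
    ring
  have hpi : (Real.pi : ℂ) ≠ 0 := Complex.ofReal_ne_zero.2 Real.pi_ne_zero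
  rw [smul_eq_mul] at heq
  field_simp
  exact mul_left_cancel₀ (mul_ne_zero two_ne_zero Complex.I_ne_zero) (by linear_combination -heq)

end Stieltjes

section Laplace

variable {E : Type*} [NormedAddCommGroup E] [NormedSpace ℂ E] {f : ℝ → E} {z : ℂ}

/-- The Laplace transform `∫_0^∞ e^{-zs} f(s) ds`. -/
def laplace (f : ℝ → E) (z : ℂ) : E :=
  ∫ s in Ioi (0 : ℝ), Complex.exp (-(z * s)) • f s

theorem norm_exp_neg_mul_ofReal_smul (z : ℂ) (s : ℝ) (x : E) :
    ‖Complex.exp (-(z * s)) • x‖ = Real.exp (-(z.re * s)) * ‖x‖ := by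
  rw [norm_smul, Complex.norm_exp]
  simp

theorem norm_laplace_le_mul_rpow {α C : ℝ} (hα : α < 1)
    (hf : ∀ t, 0 < t → ‖f t‖ ≤ C * t ^ (-α)) (hz : 0 < z.re) :
    ‖laplace f z‖ ≤ C * Real.Gamma (1 - α) * z.re ^ (-(1 - α)) := by
  have hα' : 0 < 1 - α := sub_pos.2 hα
  have hGamma := Real.integral_rpow_mul_exp_neg_mul_Ioi hα' hz
  have hint : IntegrableOn (fun t : ℝ => t ^ (1 - α - 1) * Real.exp (-(z.re * t))) (Ioi 0) :=
    .of_integral_ne_zero (by rw [hGamma]; positivity [Real.Gamma_pos_of_pos hα'])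
  calc ‖laplace f z‖
      ≤ ∫ t in Ioi (0 : ℝ), C * (t ^ (1 - α - 1) * Real.exp (-(z.re * t))) := by
        refine norm_integral_le_of_norm_le (hint.const_mul C) ?_
        filter_upwards [ae_restrict_mem measurableSet_Ioi] with t ht
        rw [norm_exp_neg_mul_ofReal_smul, mul_comm, ← mul_assoc, sub_sub_cancel_left]
        gcongr
        exact hf t ht
    _ = C * Real.Gamma (1 - α) * z.re ^ (-(1 - α)) := by
        rw [integral_const_mul, hGamma, one_div, Real.inv_rpow hz.le, Real.rpow_neg hz.le]
        ring

theorem exists_norm_laplace_le_mul_powerWeight {α β C : ℝ} (hα : α < 1) (hβ : β < 1) (hC : 0 ≤ C)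
    (hf : ∀ t, 0 < t → ‖f t‖ ≤ C * powerWeight α β t) :
    ∃ C', ∀ z : ℂ, 0 < z.re → ‖laplace f z‖ ≤ C' * powerWeight (1 - β) (1 - α) z.re := by
  refine ⟨max (C * Real.Gamma (1 - β)) (C * Real.Gamma (1 - α)), fun z hz => ?_⟩
  have hleft := norm_laplace_le_mul_rpow hα
    (fun t ht => (hf t ht).trans (by gcongr; exact powerWeight_le_left)) hz
  have hright := norm_laplace_le_mul_rpow hβ
    (fun t ht => (hf t ht).trans (by gcongr; exact powerWeight_le_right)) hz
  rw [powerWeight, mul_min_of_nonneg _ _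
    (le_max_of_le_left (mul_nonneg hC (Real.Gamma_pos_of_pos (sub_pos.2 hβ)).le))]
  refine le_min (hright.trans ?_) (hleft.trans ?_)
  · gcongr
    exact le_max_left _ _
  · gcongr
    exact le_max_right _ _

theorem stronglyMeasurable_laplace_ofReal (hf : StronglyMeasurable f) :
    StronglyMeasurable fun s : ℝ => laplace f s := by
  have hexp : Continuous fun p : ℝ × ℝ => Complex.exp (-((p.1 : ℂ) * p.2)) := by fun_prop
  exact (hexp.stronglyMeasurable.smul (hf.comp_measurable measurable_snd)).integral_prod_right'

theorem laplace_laplace [CompleteSpace E]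
    (hf : AEStronglyMeasurable f (volume.restrict (Ioi 0))) (hz : 0 < z.re)
    (hint : IntegrableOn (fun t => (z.re + t)⁻¹ * ‖f t‖) (Ioi 0)) :
    laplace (fun s : ℝ => laplace f s) z = ∫ t in Ioi (0 : ℝ), (z + t)⁻¹ • f t := by
  have hexp (s t : ℝ) : Complex.exp (-(z * s)) • Complex.exp (-((s : ℂ) * t)) • f t =
      Complex.exp (-(z + t) * s) • f t := by
    rw [smul_smul, ← Complex.exp_add]
    ring_nf
  have hre (t : ℝ) (ht : t ∈ Ioi (0 : ℝ)) : (-(z + t)).re < 0 := by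
    simpa [neg_lt_iff_pos_add] using add_pos hz ht
  have hprod : Integrable (Function.uncurry fun s t : ℝ => Complex.exp (-(z + t) * s) • f t)
      ((volume.restrict (Ioi 0)).prod (volume.restrict (Ioi 0))) := by
    refine (integrable_prod_iff' ?_).2 ⟨?_, hint.congr ?_⟩
    · exact (by unfold Function.uncurry; fun_prop : Continuous (Function.uncurry fun s t : ℝ =>
        Complex.exp (-(z + t) * s))).aestronglyMeasurable.smul hf.comp_snd
    · filter_upwards [ae_restrict_mem measurableSet_Ioi] with t ht
      exact (integrableOn_exp_mul_complex_Ioi (hre t ht) 0).smul_const (f t)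
    · filter_upwards [ae_restrict_mem measurableSet_Ioi] with t ht
      have hnorm (s : ℝ) : ‖Complex.exp (-(z + t) * s) • f t‖ =
          Real.exp (-(z.re + t) * s) * ‖f t‖ := by
        simp [norm_smul, Complex.norm_exp]
      simp only [Function.uncurry, hnorm]
      rw [integral_mul_const, integral_exp_mul_Ioi (by simpa using hre t ht)]
      simp [-neg_add_rev, neg_div_neg_eq]
  calc laplace (fun s : ℝ => laplace f s) z
      = ∫ s in Ioi (0 : ℝ), ∫ t in Ioi (0 : ℝ), Complex.exp (-(z + t) * s) • f t := by
        simp only [laplace, ← hexp, integral_smul]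
    _ = ∫ t in Ioi (0 : ℝ), ∫ s in Ioi (0 : ℝ), Complex.exp (-(z + t) * s) • f t :=
        integral_integral_swap hprod
    _ = ∫ t in Ioi (0 : ℝ), (z + t)⁻¹ • f t := by
        refine setIntegral_congr_fun measurableSet_Ioi fun t ht => ?_
        rw [integral_smul_const, integral_exp_mul_complex_Ioi (hre t ht), Complex.ofReal_zero,
          mul_zero, Complex.exp_zero, neg_div_neg_eq, one_div]

end Laplace

section Plancherel

variable {V H : Type*} [NormedAddCommGroup V] [InnerProductSpace ℝ V] [FiniteDimensional ℝ V]
  [MeasurableSpace V] [BorelSpace V]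
  [NormedAddCommGroup H] [InnerProductSpace ℂ H] [CompleteSpace H]
  {f g : V → H}

theorem integral_smul_fourier_toLp (hf : MemLp f 2) (hint : Integrable f) (u : SchwartzMap V ℂ) :
    ∫ ξ, u ξ • (𝓕 (hf.toLp f) : Lp H 2 (volume : Measure V)) ξ = ∫ ξ, u ξ • 𝓕 f ξ := by
  have hdist := congr($(Lp.fourier_toTemperedDistribution_eq (hf.toLp f)) u)
  rw [TemperedDistribution.fourier_apply, Lp.toTemperedDistribution_apply,
    Lp.toTemperedDistribution_apply] at hdist
  calc ∫ ξ, u ξ • (𝓕 (hf.toLp f) : Lp H 2 (volume : Measure V)) ξ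
      = ∫ x, 𝓕 u x • hf.toLp f x := hdist.symm
    _ = ∫ x, 𝓕 u x • f x := by
        refine integral_congr_ae ?_
        filter_upwards [hf.coeFn_toLp] with x hx
        rw [hx]
    _ = ∫ ξ, u ξ • 𝓕 f ξ := by
        have hflip := VectorFourier.integral_fourierIntegral_smul_eq_flip (L := innerₗ V)
          Real.continuous_fourierChar continuous_inner (u.integrable (μ := volume)) hint
        rwa [flip_innerₗ] at hflip

theorem fourier_toLp_ae_eq (hf : MemLp f 2) (hint : Integrable f) :
    (𝓕 (hf.toLp f) : Lp H 2 (volume : Measure V)) =ᵐ[volume] 𝓕 f := by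
  have hcont : Continuous (𝓕 f) :=
    VectorFourier.fourierIntegral_continuous Real.continuous_fourierChar continuous_inner hint
  refine ae_eq_of_integral_contDiff_smul_eq
    ((Lp.memLp (𝓕 (hf.toLp f))).locallyIntegrable one_le_two) hcont.locallyIntegrable
    fun u hu hsupp => ?_
  have hsupp' : HasCompactSupport fun x => (u x : ℂ) := hsupp.comp_left Complex.ofReal_zero
  exact integral_smul_fourier_toLp hf hint
    (hsupp'.toSchwartzMap (Complex.ofRealCLM.contDiff.comp hu))

theorem norm_toLp_two_sq {α E : Type*} [MeasurableSpace α] {μ : Measure α} [NormedAddCommGroup E]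
    {f : α → E} (hf : MemLp f 2 μ) : ‖hf.toLp f‖ ^ 2 = ∫ x, ‖f x‖ ^ 2 ∂μ := by
  rw [Lp.norm_toLp, hf.eLpNorm_eq_integral_rpow_norm two_ne_zero ENNReal.ofNat_ne_top,
    ENNReal.toReal_ofReal (by positivity), ← Real.rpow_natCast, ← Real.rpow_mul (by positivity)]
  norm_num

theorem integral_norm_sq_eq_of_fourier_toLp_ae_eq (hf : MemLp f 2)
    (h : (𝓕 (hf.toLp f) : Lp H 2 (volume : Measure V)) =ᵐ[volume] g) :
    ∫ ξ, ‖g ξ‖ ^ 2 = ∫ x, ‖f x‖ ^ 2 := by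
  have hg : MemLp g 2 := (memLp_congr_ae h).1 (Lp.memLp _)
  rw [← norm_toLp_two_sq hf, ← norm_toLp_two_sq hg, ← Lp.norm_fourier_eq (hf.toLp f)]
  congr 2
  exact Lp.ext (hg.coeFn_toLp.trans h.symm)

theorem tendsto_eLpNorm_zero_of_dominated {α ι E : Type*} [MeasurableSpace α] {μ : Measure α}
    [NormedAddCommGroup E] {l : Filter ι} [l.IsCountablyGenerated] {p : ENNReal} {F : ι → α → E}
    {g : α → ℝ} (hp0 : p ≠ 0) (hp : p ≠ ⊤) (hF : ∀ᶠ n in l, AEStronglyMeasurable (F n) μ)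
    (hg : MemLp g p μ) (hbound : ∀ᶠ n in l, ∀ᵐ x ∂μ, ‖F n x‖ ≤ g x)
    (hlim : ∀ᵐ x ∂μ, Tendsto (fun n => F n x) l (𝓝 0)) :
    Tendsto (fun n => eLpNorm (F n) p μ) l (𝓝 0) := by
  have hp_pos : 0 < p.toReal := ENNReal.toReal_pos hp0 hp
  have hzero (q : ℝ) (hq : 0 < q) : Tendsto (fun y : ENNReal => y ^ q) (𝓝 0) (𝓝 0) := by
    simpa [ENNReal.zero_rpow_of_pos hq] using (ENNReal.continuous_rpow_const (y := q)).tendsto 0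
  have hint : Tendsto (fun n => ∫⁻ x, ‖F n x‖ₑ ^ p.toReal ∂μ) l (𝓝 (∫⁻ _, 0 ∂μ)) := by
    refine tendsto_lintegral_filter_of_dominated_convergence' (fun x => ‖g x‖ₑ ^ p.toReal)
      (hF.mono fun n hn => hn.enorm.pow_const _) (hbound.mono fun n hn => hn.mono fun x hx => ?_)
      (lintegral_rpow_enorm_lt_top_of_eLpNorm_lt_top hp0 hp hg.2).ne
      (hlim.mono fun x hx => (hzero _ hp_pos).comp ?_)
    · gcongr
      exact enorm_le_iff_norm_le.2 (hx.trans (le_abs_self _))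
    · simpa using hx.enorm
  rw [lintegral_zero] at hint
  simp only [eLpNorm_eq_lintegral_rpow_enorm_toReal hp0 hp]
  exact (hzero _ (one_div_pos.2 hp_pos)).comp hint

end Plancherel

section Damp

variable {E : Type*} [NormedAddCommGroup E] [NormedSpace ℝ E] {a : ℝ} {p : ENNReal} {f : ℝ → E}

/-- The damped function `s ↦ e^{-as} f(s)`; on the line `Re z = a` the Laplace transform of `f` is
the Fourier transform of `damp a f`. -/
def damp (a : ℝ) (f : ℝ → E) (s : ℝ) : E :=
  Real.exp (-(a * s)) • f s

theorem damp_zero : damp 0 f = f := by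
  ext s
  simp [damp]

theorem norm_damp_le (ha : 0 ≤ a) (hsupp : ∀ s < 0, f s = 0) (s : ℝ) : ‖damp a f s‖ ≤ ‖f s‖ := by
  rcases lt_or_ge s 0 with hs | hs
  · simp [damp, hsupp s hs]
  · rw [damp, norm_smul, Real.norm_eq_abs, Real.abs_exp]
    exact mul_le_of_le_one_left (norm_nonneg _)
      (Real.exp_le_one_iff.2 (neg_nonpos.2 (mul_nonneg ha hs)))

theorem aestronglyMeasurable_damp (hf : AEStronglyMeasurable f) :
    AEStronglyMeasurable (damp a f) :=
  (by fun_prop : Continuous fun s => Real.exp (-(a * s))).aestronglyMeasurable.smul hf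

theorem memLp_damp (ha : 0 ≤ a) (hf : MemLp f p) (hsupp : ∀ s < 0, f s = 0) :
    MemLp (damp a f) p :=
  hf.mono (aestronglyMeasurable_damp hf.1) (.of_forall (norm_damp_le ha hsupp))

theorem integrable_damp (ha : 0 < a) (hf : MemLp f 2) (hsupp : ∀ s < 0, f s = 0) :
    Integrable (damp a f) := by
  have hexp : MemLp ((Ici (0 : ℝ)).indicator fun s => Real.exp (-(a * s))) 2 := by
    rw [memLp_indicator_iff_restrict measurableSet_Ici, ← restrict_Ioi_eq_restrict_Ici,
      memLp_two_iff_integrable_sq (by fun_prop)]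
    refine (integrableOn_exp_mul_Ioi (a := -(2 * a)) (by linarith) 0).congr (.of_forall fun s => ?_)
    simp only [← Real.exp_nat_mul]
    ring_nf
  refine (memLp_one_iff_integrable.1 (hf.smul hexp)).congr (.of_forall fun s => ?_)
  rcases lt_or_ge s 0 with hs | hs
  · simp [damp, hsupp s hs]
  · simp [damp, hs]

theorem tendsto_eLpNorm_damp_sub (hp0 : p ≠ 0) (hp : p ≠ ⊤) (hf : MemLp f p)
    (hsupp : ∀ s < 0, f s = 0) :
    Tendsto (fun a => eLpNorm (damp a f - f) p) (𝓝[>] 0) (𝓝 0) := by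
  refine tendsto_eLpNorm_zero_of_dominated hp0 hp
    (.of_forall fun a => (aestronglyMeasurable_damp hf.1).sub hf.1) (hf.norm.const_mul 2) ?_
    (.of_forall fun s => ?_)
  · filter_upwards [self_mem_nhdsWithin] with a ha
    refine .of_forall fun s => ?_
    calc ‖damp a f s - f s‖ ≤ ‖damp a f s‖ + ‖f s‖ := norm_sub_le _ _
      _ ≤ 2 * ‖f s‖ := by linarith [norm_damp_le (le_of_lt ha) hsupp s]
  · have hcont : Continuous fun a => damp a f s - f s := by
      unfold damp
      fun_prop
    simpa [damp] using hcont.continuousWithinAt (s := Ioi 0) (x := 0) |>.tendsto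

theorem tendsto_integral_norm_sq_damp (hf : MemLp f 2) (hsupp : ∀ s < 0, f s = 0) :
    Tendsto (fun a => ∫ s, ‖damp a f s‖ ^ 2) (𝓝[>] 0) (𝓝 (∫ s, ‖f s‖ ^ 2)) := by
  refine tendsto_integral_filter_of_dominated_convergence (fun s => ‖f s‖ ^ 2)
    (.of_forall fun a => (aestronglyMeasurable_damp hf.1).norm.pow 2) ?_
    ((memLp_two_iff_integrable_sq_norm hf.1).1 hf) (.of_forall fun s => ?_)
  · filter_upwards [self_mem_nhdsWithin] with a ha
    refine .of_forall fun s => ?_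
    rw [Real.norm_of_nonneg (by positivity)]
    gcongr
    exact norm_damp_le (le_of_lt ha) hsupp s
  · have hcont : Continuous fun a => ‖damp a f s‖ ^ 2 := by
      unfold damp
      fun_prop
    simpa [damp] using hcont.continuousWithinAt (s := Ioi 0) (x := 0) |>.tendsto

end Damp

theorem memLp_comp_mul_left {E : Type*} [NormedAddCommGroup E] {p : ENNReal} {g : ℝ → E} {c : ℝ}
    (hg : MemLp g p) (hc : c ≠ 0) : MemLp (fun x => g (c * x)) p := by
  refine (measurableEmbedding_mulLeft₀ hc).memLp_map_measure_iff.1 ?_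
  rw [Real.map_volume_mul_left hc]
  exact hg.smul_measure ENNReal.ofReal_ne_top

section PaleyWiener

variable {H : Type*} [NormedAddCommGroup H] [InnerProductSpace ℂ H] {f : ℝ → H} {F : ℂ → H} {a : ℝ}

theorem fourier_damp (hsupp : ∀ s < 0, f s = 0) (ξ : ℝ) :
    𝓕 (damp a f) ξ = laplace f (a + Complex.I * (2 * Real.pi * ξ : ℝ)) := by
  have hzero (s : ℝ) (hs : s ∉ Ici (0 : ℝ)) :
      Complex.exp (-((a + Complex.I * (2 * Real.pi * ξ : ℝ)) * s)) • f s = 0 := by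
    rw [hsupp s (not_le.1 hs), smul_zero]
  rw [Real.fourier_real_eq_integral_exp_smul, laplace, ← integral_Ici_eq_integral_Ioi,
    setIntegral_eq_integral_of_forall_compl_eq_zero hzero]
  congr with s
  rw [damp, ← Complex.coe_smul, smul_smul, Complex.ofReal_exp, ← Complex.exp_add]
  congr 2
  push_cast
  ring

variable [CompleteSpace H]

theorem fourier_toLp_ae_eq_of_tendsto_laplace (hf : MemLp f 2) (hsupp : ∀ s < 0, f s = 0)
    (hF : ∀ z : ℂ, 0 < z.re → laplace f z = F z)
    (hlim : ∀ᵐ t : ℝ, Tendsto (fun a : ℝ => F (a + Complex.I * t)) (𝓝[>] 0)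
      (𝓝 (F (Complex.I * t)))) :
    (𝓕 (hf.toLp f) : Lp H 2 (volume : Measure ℝ)) =ᵐ[volume]
      fun ξ => F (Complex.I * (2 * Real.pi * ξ : ℝ)) := by
  obtain ⟨u, -, hu_pos, hu⟩ := exists_seq_strictAnti_tendsto (0 : ℝ)
  have hdamp (n : ℕ) : MemLp (damp (u n) f) 2 := memLp_damp (hu_pos n).le hf hsupp
  have hLp : Tendsto (fun n => (𝓕 ((hdamp n).toLp _) : Lp H 2 (volume : Measure ℝ))) atTop
      (𝓝 (𝓕 (hf.toLp f))) :=
    (FourierTransform.continuous_fourier.tendsto _).comp <|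
      (Lp.tendsto_Lp_iff_tendsto_eLpNorm'' _ hdamp _ hf).2 <|
        (tendsto_eLpNorm_damp_sub two_ne_zero ENNReal.ofNat_ne_top hf hsupp).comp <|
          tendsto_nhdsWithin_iff.2 ⟨hu, .of_forall hu_pos⟩
  obtain ⟨k, hk, hae⟩ := (tendstoInMeasure_of_tendsto_Lp hLp).exists_seq_tendsto_ae
  have hline (n : ℕ) := fourier_toLp_ae_eq (hdamp n) (integrable_damp (hu_pos n) hf hsupp)
  filter_upwards [hae, ae_all_iff.2 hline,
    (Measure.quasiMeasurePreserving_smul volume (by positivity : 2 * Real.pi ≠ 0)).ae hlim]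
    with ξ hξ hξ_line hξ_lim
  refine tendsto_nhds_unique hξ ((hξ_lim.comp <| tendsto_nhdsWithin_iff.2
    ⟨hu.comp hk.tendsto_atTop, .of_forall fun n => hu_pos (k n)⟩).congr fun n => ?_)
  rw [hξ_line, fourier_damp hsupp, hF _ (by simpa using hu_pos (k n))]
  rfl

theorem fourier_toLp_damp_ae_eq (hf : MemLp f 2) (hsupp : ∀ s < 0, f s = 0)
    (hF : ∀ z : ℂ, 0 < z.re → laplace f z = F z)
    (hlim : ∀ᵐ t : ℝ, Tendsto (fun a : ℝ => F (a + Complex.I * t)) (𝓝[>] 0)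
      (𝓝 (F (Complex.I * t)))) (ha : 0 ≤ a) :
    (𝓕 ((memLp_damp ha hf hsupp).toLp _) : Lp H 2 (volume : Measure ℝ)) =ᵐ[volume]
      fun ξ => F (a + Complex.I * (2 * Real.pi * ξ : ℝ)) := by
  rcases ha.eq_or_lt with rfl | ha'
  · simpa only [damp_zero, Complex.ofReal_zero, zero_add]
      using fourier_toLp_ae_eq_of_tendsto_laplace hf hsupp hF hlim
  · refine (fourier_toLp_ae_eq _ (integrable_damp ha' hf hsupp)).trans (.of_forall fun ξ => ?_)
    rw [fourier_damp hsupp, hF _ (by simpa using ha')]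

theorem memLp_vertical (hf : MemLp f 2) (hsupp : ∀ s < 0, f s = 0)
    (hF : ∀ z : ℂ, 0 < z.re → laplace f z = F z)
    (hlim : ∀ᵐ t : ℝ, Tendsto (fun a : ℝ => F (a + Complex.I * t)) (𝓝[>] 0)
      (𝓝 (F (Complex.I * t)))) (ha : 0 ≤ a) :
    MemLp (fun t : ℝ => F (a + Complex.I * t)) 2 := by
  have hξ := (memLp_congr_ae (fourier_toLp_damp_ae_eq hf hsupp hF hlim ha)).1 (Lp.memLp _)
  have htwo_pi : 2 * Real.pi ≠ 0 := Real.two_pi_pos.ne'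
  simpa only [mul_inv_cancel_left₀ htwo_pi]
    using memLp_comp_mul_left hξ (inv_ne_zero htwo_pi)

theorem integral_norm_sq_vertical (hf : MemLp f 2) (hsupp : ∀ s < 0, f s = 0)
    (hF : ∀ z : ℂ, 0 < z.re → laplace f z = F z)
    (hlim : ∀ᵐ t : ℝ, Tendsto (fun a : ℝ => F (a + Complex.I * t)) (𝓝[>] 0)
      (𝓝 (F (Complex.I * t)))) (ha : 0 ≤ a) :
    ∫ t : ℝ, ‖F (a + Complex.I * t)‖ ^ 2 / (2 * Real.pi) = ∫ s, ‖damp a f s‖ ^ 2 := by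
  rw [← integral_norm_sq_eq_of_fourier_toLp_ae_eq _ (fourier_toLp_damp_ae_eq hf hsupp hF hlim ha),
    integral_div, Measure.integral_comp_mul_left fun t : ℝ => ‖F (a + Complex.I * t)‖ ^ 2,
    abs_of_pos (by positivity), smul_eq_mul, div_eq_inv_mul]

theorem integral_norm_sq_imaginary_axis (hf : MemLp f 2) (hsupp : ∀ s < 0, f s = 0)
    (hF : ∀ z : ℂ, 0 < z.re → laplace f z = F z)
    (hlim : ∀ᵐ t : ℝ, Tendsto (fun a : ℝ => F (a + Complex.I * t)) (𝓝[>] 0)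
      (𝓝 (F (Complex.I * t)))) :
    ∫ t : ℝ, ‖F (Complex.I * t)‖ ^ 2 / (2 * Real.pi) = ∫ s, ‖f s‖ ^ 2 := by
  simpa only [Complex.ofReal_zero, zero_add, damp_zero]
    using integral_norm_sq_vertical hf hsupp hF hlim le_rfl

theorem tendsto_integral_norm_sq_vertical (hf : MemLp f 2) (hsupp : ∀ s < 0, f s = 0)
    (hF : ∀ z : ℂ, 0 < z.re → laplace f z = F z)
    (hlim : ∀ᵐ t : ℝ, Tendsto (fun a : ℝ => F (a + Complex.I * t)) (𝓝[>] 0)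
      (𝓝 (F (Complex.I * t)))) :
    Tendsto (fun a : ℝ => ∫ t : ℝ, ‖F (a + Complex.I * t)‖ ^ 2 / (2 * Real.pi)) (𝓝[>] 0)
      (𝓝 (∫ t : ℝ, ‖F (Complex.I * t)‖ ^ 2 / (2 * Real.pi))) := by
  rw [integral_norm_sq_imaginary_axis hf hsupp hF hlim]
  refine (tendsto_integral_norm_sq_damp hf hsupp).congr' ?_
  filter_upwards [self_mem_nhdsWithin] with a ha
  exact (integral_norm_sq_vertical hf hsupp hF hlim (le_of_lt ha)).symm

end PaleyWiener

section Log

open Asymptotics Bornology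

theorem continuousOn_log_upper : ContinuousOn Complex.log ({z : ℂ | 0 ≤ z.im} \ {0}) := by
  rintro z ⟨-, hz⟩
  by_cases h : z ∈ Complex.slitPlane
  · exact (continuousAt_clog h).continuousWithinAt
  · rw [Complex.mem_slitPlane_iff, not_or, not_lt, not_ne_iff] at h
    have hre : z.re < 0 := h.1.lt_of_ne fun hre => hz (Complex.ext hre h.2)
    exact (Complex.continuousWithinAt_log_of_re_neg_of_im_zero hre h.2).mono sdiff_subset

theorem log_ne_zero {z : ℂ} (h0 : z ≠ 0) (h1 : z ≠ 1) : Complex.log z ≠ 0 := fun h => h1 <| by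
  rw [← Complex.exp_log h0, h, Complex.exp_zero]

theorem log_neg_ofReal {t : ℝ} (ht : 0 < t) :
    Complex.log (-(t : ℂ)) = Real.log t + Real.pi * Complex.I := by
  rw [Complex.log, norm_neg, Complex.norm_real, Real.norm_of_nonneg ht.le, ← Complex.ofReal_neg,
    Complex.arg_ofReal_of_neg (neg_lt_zero.2 ht)]

theorem log_one_add_eq {z : ℂ} (him : 0 ≤ z.im) (hz : 1 + z⁻¹ ∈ Complex.slitPlane) :
    Complex.log (1 + z) = Complex.log z + Complex.log (1 + z⁻¹) := by
  rcases eq_or_ne z 0 with rfl | hz0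
  · simp
  have harg : (1 + z⁻¹).arg ≤ 0 := by
    have him' : (1 + z⁻¹).im ≤ 0 := by
      simpa [Complex.inv_im] using div_nonpos_of_nonpos_of_nonneg (neg_nonpos.2 him)
        (Complex.normSq_nonneg z)
    rcases him'.lt_or_eq with h | h
    · exact (Complex.arg_neg_iff.2 h).le
    · have hre : 0 < (1 + z⁻¹).re := (Complex.mem_slitPlane_iff.1 hz).resolve_right (not_not.2 h)
      exact (Complex.arg_eq_zero_iff.2 ⟨hre.le, h⟩).le
  rw [← Complex.log_mul hz0 (Complex.slitPlane_ne_zero hz)]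
  · rw [mul_add, mul_one, mul_inv_cancel₀ hz0, add_comm]
  · exact ⟨by linarith [Complex.arg_nonneg_iff.2 him, Complex.neg_pi_lt_arg (1 + z⁻¹)],
      by linarith [Complex.arg_le_pi z]⟩

theorem tendsto_log_cobounded_of_abs_log_norm {l : Filter ℂ}
    (h : Tendsto (fun z : ℂ => |Real.log ‖z‖|) l atTop) :
    Tendsto Complex.log l (cobounded ℂ) := by
  refine tendsto_norm_atTop_iff_cobounded.1 (tendsto_atTop_mono (fun z => ?_) h)
  rw [← Complex.log_re]
  exact Complex.abs_re_le_norm _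

theorem tendsto_log_nhdsNE_zero : Tendsto Complex.log (𝓝[≠] 0) (cobounded ℂ) :=
  tendsto_log_cobounded_of_abs_log_norm <|
    tendsto_abs_atBot_atTop.comp <| Real.tendsto_log_nhdsGT_zero.comp tendsto_norm_nhdsNE_zero

theorem tendsto_log_cobounded : Tendsto Complex.log (cobounded ℂ) (cobounded ℂ) :=
  tendsto_log_cobounded_of_abs_log_norm <|
    tendsto_abs_atTop_atTop.comp <| Real.tendsto_log_atTop.comp tendsto_norm_cobounded_atTop

theorem continuousAt_inv_log_zero : ContinuousAt (fun z : ℂ => (Complex.log z)⁻¹) 0 := by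
  rw [continuousAt_iff_punctured_nhds, Complex.log_zero, inv_zero]
  exact tendsto_inv₀_cobounded.comp tendsto_log_nhdsNE_zero

theorem continuousOn_inv_log_upper :
    ContinuousOn (fun z => (Complex.log z)⁻¹) ({z : ℂ | 0 ≤ z.im} \ {1}) := by
  rintro z ⟨him, hz⟩
  rcases eq_or_ne z 0 with rfl | h0
  · exact continuousAt_inv_log_zero.continuousWithinAt
  · refine ContinuousWithinAt.inv₀ ?_ (log_ne_zero h0 hz)
    refine (continuousOn_log_upper z ⟨him, h0⟩).mono_of_mem_nhdsWithin ?_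
    filter_upwards [mem_nhdsWithin_of_mem_nhds (isOpen_ne.mem_nhds h0), self_mem_nhdsWithin]
      with w hw0 hw
    exact ⟨hw.1, hw0⟩

theorem isBigO_one_norm_rpow {E : Type*} [NormedAddCommGroup E] {s : ℝ} (hs : s ≤ 0) :
    (fun _ : E => (1 : ℝ)) =O[𝓝[≠] 0] fun z => ‖z‖ ^ s := by
  refine .of_bound 1 ?_
  filter_upwards [self_mem_nhdsWithin, mem_nhdsWithin_of_mem_nhds (Metric.ball_mem_nhds 0 one_pos)]
    with z hz0 hz
  rw [norm_one, one_mul, Real.norm_of_nonneg (by positivity)]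
  exact Real.one_le_rpow_of_pos_of_le_one_of_nonpos (norm_pos_iff.2 hz0)
    (mem_ball_zero_iff.1 hz).le hs

theorem isBigO_log_norm_rpow {s : ℝ} (hs : s < 0) :
    Complex.log =O[𝓝[≠] 0] fun z => ‖z‖ ^ s := by
  have hre : (fun z : ℂ => Real.log ‖z‖) =O[𝓝[≠] 0] fun z => ‖z‖ ^ s :=
    (isLittleO_log_rpow_nhdsGT_zero hs).isBigO.comp_tendsto tendsto_norm_nhdsNE_zero
  have him : Complex.arg =O[𝓝[≠] 0] fun z => ‖z‖ ^ s :=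
    (IsBigO.of_bound Real.pi (.of_forall fun z => by simpa using Complex.abs_arg_le_pi z)).trans
      (isBigO_one_norm_rpow hs.le)
  refine (IsBigO.of_bound' (.of_forall fun z => ?_)).trans (hre.norm_left.add him.norm_left)
  rw [Real.norm_of_nonneg (by positivity), Real.norm_eq_abs, Real.norm_eq_abs, ← Complex.log_re,
    ← Complex.log_im]
  exact Complex.norm_le_abs_re_add_abs_im _

theorem tendsto_div_log_one_add :
    Tendsto (fun z : ℂ => z / Complex.log (1 + z)) (𝓝[≠] 0) (𝓝 1) := by
  simpa [div_eq_inv_mul] using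
    (Complex.hasDerivAt_log Complex.one_mem_slitPlane).tendsto_slope_zero.inv₀ (by simp)

end Log

section G

open Asymptotics Bornology

theorem one_add_mem_slitPlane {z : ℂ} (hz : z ∈ Complex.slitPlane) :
    1 + z ∈ Complex.slitPlane := by
  rw [Complex.mem_slitPlane_iff] at *
  rcases hz with hre | him
  · exact .inl (by simpa using by linarith)
  · exact .inr (by simpa using him)

theorem continuousOn_G : ContinuousOn G ({z : ℂ | 0 ≤ z.im} \ {0}) := by
  have hinv : ContinuousOn (fun z : ℂ => (Complex.log (1 + z))⁻¹) ({z : ℂ | 0 ≤ z.im} \ {0}) :=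
    continuousOn_inv_log_upper.comp (f := fun z : ℂ => 1 + z) (by fun_prop) fun z hz => by
      simpa using hz
  unfold G
  simp only [div_eq_mul_inv]
  exact ((continuousOn_const.sub (continuousOn_log_upper.mul hinv)).mul continuousOn_id).mul
    continuousOn_log_upper

theorem differentiableAt_G {z : ℂ} (hz : z ∈ Complex.slitPlane) : DifferentiableAt ℂ G z := by
  have hne : Complex.log (1 + z) ≠ 0 :=
    log_ne_zero (Complex.slitPlane_ne_zero (one_add_mem_slitPlane hz))
      (by simpa using Complex.slitPlane_ne_zero hz)
  have hlog : DifferentiableAt ℂ Complex.log z := Complex.differentiableAt_log hz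
  have hlog_one_add : DifferentiableAt ℂ (fun z : ℂ => Complex.log (1 + z)) z :=
    (differentiableAt_id.const_add 1).clog (one_add_mem_slitPlane hz)
  exact (((differentiableAt_const _).sub (hlog.div hlog_one_add hne)).mul differentiableAt_id).mul
    hlog

theorem G_conj {z : ℂ} (hz : z ∈ Complex.slitPlane) : G (conj z) = conj (G z) := by
  have hlog {w : ℂ} (hw : w ∈ Complex.slitPlane) :
      Complex.log (conj w) = conj (Complex.log w) :=
    Complex.log_conj _ (Complex.slitPlane_arg_ne_pi hw)
  have hlog_one_add := hlog (one_add_mem_slitPlane hz)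
  rw [map_add, map_one] at hlog_one_add
  simp [G, hlog hz, hlog_one_add]

theorem im_G_neg {t : ℝ} (ht : 0 < t) : (G (-t)).im = Real.pi * rho t := by
  rcases lt_trichotomy t 1 with h | rfl | h
  · have hlog : Complex.log (1 + -(t : ℂ)) = Real.log (1 - t) := by
      rw [Complex.ofReal_log (by linarith)]
      push_cast
      ring_nf
    have hne : Real.log (1 - t) ≠ 0 := (Real.log_neg (by linarith) (by linarith)).ne
    rw [G, rho, log_neg_ofReal ht, hlog, if_pos h, Real.log_div (by linarith) (by positivity),
      Real.log_pow]
    simp only [mul_neg, neg_mul, Complex.neg_im, Complex.mul_im, Complex.mul_re, Complex.sub_re,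
      Complex.one_re, Complex.div_re, Complex.add_re, Complex.ofReal_re, Complex.I_re, mul_zero,
      Complex.ofReal_im, Complex.I_im, mul_one, sub_self, add_zero, Complex.normSq_apply,
      Complex.add_im, zero_add, zero_div, Complex.sub_im, Complex.one_im, Complex.div_im, sub_zero,
      zero_sub, neg_add_rev, neg_neg, Nat.cast_ofNat]
    field_simp
    ring
  · simp [G, rho, Complex.log_neg_one]
  · have hlog : Complex.log (1 + -(t : ℂ)) = Real.log (t - 1) + Real.pi * Complex.I := by
      rw [← log_neg_ofReal (by linarith)]
      push_cast
      ring_nf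
    rw [G, rho, log_neg_ofReal ht, hlog, if_neg (by linarith), if_pos h,
      Real.log_div (by linarith) (by linarith)]
    simp only [mul_neg, neg_mul, Complex.neg_im, Complex.mul_im, Complex.mul_re, Complex.sub_re,
      Complex.one_re, Complex.div_re, Complex.add_re, Complex.ofReal_re, Complex.I_re, mul_zero,
      Complex.ofReal_im, Complex.I_im, mul_one, sub_self, add_zero, Complex.normSq_apply,
      Complex.add_im, zero_add, Complex.sub_im, Complex.one_im, Complex.div_im, zero_sub, neg_sub,
      sub_zero, neg_add_rev]
    field_simp
    ring

theorem isBigO_one_sub_G_zero {s : ℝ} (hs : s < 0) :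
    (fun z => 1 - G z) =O[𝓝[≠] 0] fun z => ‖z‖ ^ s := by
  have hone : (fun _ : ℂ => (1 : ℂ)) =O[𝓝[≠] 0] fun z => ‖z‖ ^ s :=
    (isBigO_const_const 1 one_ne_zero _).trans (isBigO_one_norm_rpow hs.le)
  have hid : (fun z : ℂ => z) =O[𝓝[≠] 0] fun _ => (1 : ℝ) :=
    (tendsto_id.mono_left nhdsWithin_le_nhds).isBigO_one ℝ
  have hquot : (fun z : ℂ => z / Complex.log (1 + z)) =O[𝓝[≠] 0] fun _ => (1 : ℝ) :=
    tendsto_div_log_one_add.isBigO_one ℝ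
  have hlog : Complex.log =O[𝓝[≠] 0] fun z => ‖z‖ ^ s := isBigO_log_norm_rpow hs
  have hlog_sq : (fun z => Complex.log z * Complex.log z) =O[𝓝[≠] 0] fun z => ‖z‖ ^ s := by
    have hhalf : Complex.log =O[𝓝[≠] 0] fun z => ‖z‖ ^ (s / 2) :=
      isBigO_log_norm_rpow (by linarith)
    refine (hhalf.mul hhalf).congr' .rfl ?_
    filter_upwards [self_mem_nhdsWithin] with z hz
    rw [← Real.rpow_add (norm_pos_iff.2 hz), add_halves]
  have hsum := (hone.sub ((hid.mul hlog).congr_right fun z => one_mul _)).add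
    ((hquot.mul hlog_sq).congr_right fun z => one_mul _)
  refine hsum.congr_left fun z => ?_
  rw [G]
  ring

theorem isBigO_one_sub_G_cobounded :
    (fun z => 1 - G z) =O[cobounded ℂ ⊓ 𝓟 {z | 0 ≤ z.im}] fun z => z⁻¹ := by
  set l := cobounded ℂ ⊓ 𝓟 {z | 0 ≤ z.im}
  set u : ℂ → ℂ := fun z => Complex.log (1 + z⁻¹)
  have hinv : Tendsto (fun z : ℂ => z⁻¹) l (𝓝 0) := tendsto_inv₀_cobounded.mono_left inf_le_left
  have hid : (fun z : ℂ => z) =O[l] fun z => z := isBigO_refl _ _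
  have hu_sub : (fun z => u z - z⁻¹) =O[l] fun z => z⁻¹ ^ 2 :=
    Complex.log_sub_self_isBigO.comp_tendsto hinv
  have hu : u =O[l] fun z => z⁻¹ := by
    have hsq : (fun z : ℂ => z⁻¹ ^ 2) =O[l] fun z => z⁻¹ := by
      simpa [sq] using (hinv.isBigO_one ℂ).mul (isBigO_refl (fun z : ℂ => z⁻¹) l)
    simpa using (hu_sub.trans hsq).add (isBigO_refl (fun z : ℂ => z⁻¹) l)
  have hL : Tendsto (fun z => Complex.log (1 + z)) l (cobounded ℂ) :=
    (tendsto_log_cobounded.comp (tendsto_const_add_cobounded 1)).mono_left inf_le_left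
  have hLinv : (fun z => (Complex.log (1 + z))⁻¹) =O[l] fun _ => (1 : ℂ) :=
    (tendsto_inv₀_cobounded.comp hL).isBigO_one ℂ
  have hsum : (fun z => -(z * (u z - z⁻¹)) + z * (u z * u z) * (Complex.log (1 + z))⁻¹) =O[l]
      fun z => z⁻¹ := by
    refine .add ((hid.mul hu_sub).neg_left.congr_right fun z => ?_)
      (((hid.mul (hu.mul hu)).mul hLinv).congr_right fun z => ?_) <;> field_simp
  refine hsum.congr' ?_ .rfl
  filter_upwards [hL.eventually_ne_cobounded 0, hinv.eventually (Metric.ball_mem_nhds 0 one_pos),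
    mem_inf_of_left (eventually_ne_cobounded 0), mem_inf_of_right (mem_principal_self _)]
    with z hLz hinv_lt hz him
  have hlog : Complex.log z = Complex.log (1 + z) - u z := eq_sub_of_add_eq
    (log_one_add_eq him (Complex.mem_slitPlane_of_norm_lt_one (mem_ball_zero_iff.1 hinv_lt))).symm
  rw [G, hlog]
  field_simp
  ring

end G

section Density

open Asymptotics Bornology

theorem exists_norm_one_sub_G_le : ∃ C, 0 ≤ C ∧ ∀ z : ℂ, 0 ≤ z.im → z ≠ 0 →
    ‖1 - G z‖ ≤ C * powerWeight (1 / 4) (3 / 4) ‖z‖ := by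
  refine exists_norm_le_mul_powerWeight (by norm_num)
    (isClosed_le continuous_const Complex.continuous_im) (continuousOn_const.sub continuousOn_G)
    ((isBigO_one_sub_G_zero (by norm_num)).mono (nhdsWithin_mono _ fun z hz => hz.2))
    (isBigO_one_sub_G_cobounded.trans (.of_bound' ?_))
  have hlarge : ∀ᶠ z : ℂ in cobounded ℂ, 1 ≤ ‖z‖ :=
    tendsto_norm_cobounded_atTop.eventually_ge_atTop 1
  filter_upwards [mem_inf_of_left hlarge] with z hz
  rw [norm_inv, ← Real.rpow_neg_one, Real.norm_of_nonneg (by positivity)]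
  exact Real.rpow_le_rpow_of_exponent_le hz (by norm_num)

theorem tendsto_mul_one_sub_G_zero :
    Tendsto (fun z => z * (1 - G z)) (𝓝[≠] 0) (𝓝 0) := by
  have hO : (fun z => z * (1 - G z)) =O[𝓝[≠] 0] fun z => ‖z‖ ^ (1 / 2 : ℝ) := by
    refine ((isBigO_refl (fun z : ℂ => z) _).norm_right.mul
      (isBigO_one_sub_G_zero (s := -(1 / 2)) (by norm_num))).congr_right fun z => ?_
    rw [← Real.rpow_one_add' (norm_nonneg _) (by norm_num)]
    norm_num
  refine hO.trans_tendsto ?_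
  have hcont : ContinuousAt (fun z : ℂ => ‖z‖ ^ (1 / 2 : ℝ)) 0 := by fun_prop (disch := norm_num)
  simpa using hcont.tendsto.mono_left nhdsWithin_le_nhds

theorem tendsto_one_sub_G_cobounded :
    Tendsto (fun z => 1 - G z) (cobounded ℂ ⊓ 𝓟 {z | 0 ≤ z.im}) (𝓝 0) :=
  isBigO_one_sub_G_cobounded.trans_tendsto (tendsto_inv₀_cobounded.mono_left inf_le_left)

theorem measurable_rho : Measurable rho := by
  unfold rho
  refine Measurable.ite measurableSet_Iio (by fun_prop) (Measurable.ite measurableSet_Ioi ?_ ?_) <;>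
    fun_prop

theorem exists_norm_rho_le : ∃ C, 0 ≤ C ∧ ∀ t, 0 < t →
    ‖(rho t : ℂ)‖ ≤ C * powerWeight (1 / 4) (3 / 4) t := by
  obtain ⟨C, hC, hG⟩ := exists_norm_one_sub_G_le
  refine ⟨C / Real.pi, by positivity, fun t ht => ?_⟩
  have hrho : Real.pi * rho t = -(1 - G (-t)).im := by simp [im_G_neg ht]
  rw [div_mul_eq_mul_div, le_div_iff₀' Real.pi_pos, Complex.norm_real,
    ← Real.norm_of_nonneg Real.pi_pos.le, ← norm_mul, hrho, norm_neg]
  refine (Complex.abs_im_le_norm _).trans ?_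
  simpa [abs_of_pos ht] using hG (-t) (by simp) (by simpa using ht.ne')

theorem phi_eq_laplace (s : ℝ) : (phi s : ℂ) = laplace (fun t => (rho t : ℂ)) s := by
  rw [phi, laplace, ← integral_complex_ofReal]
  congr with t
  push_cast
  rfl

theorem stronglyMeasurable_phi : StronglyMeasurable fun s => (phi s : ℂ) := by
  simp only [phi_eq_laplace]
  exact stronglyMeasurable_laplace_ofReal
    (Complex.measurable_ofReal.comp measurable_rho).stronglyMeasurable

theorem memLp_phiPos : MemLp phiPos 2 := by
  obtain ⟨C, hC, hrho⟩ := exists_norm_rho_le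
  obtain ⟨C', hC'⟩ := exists_norm_laplace_le_mul_powerWeight (by norm_num) (by norm_num) hC hrho
  unfold phiPos
  rw [memLp_indicator_iff_restrict measurableSet_Ici, ← restrict_Ioi_eq_restrict_Ici]
  refine ((memLp_two_powerWeight (α := 1 - 3 / 4) (β := 1 - 1 / 4) (by norm_num)
    (by norm_num)).const_mul C').mono' stronglyMeasurable_phi.aestronglyMeasurable ?_
  filter_upwards [ae_restrict_mem measurableSet_Ioi] with s hs
  simpa only [phi_eq_laplace, Complex.ofReal_re] using hC' s (by simpa using hs)

theorem memLp_phi : MemLp phi 2 (volume.restrict (Ici (0 : ℝ))) := by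
  have h := (memLp_indicator_iff_restrict measurableSet_Ici).1 memLp_phiPos
  exact h.re

theorem phiPos_of_neg {s : ℝ} (hs : s < 0) : phiPos s = 0 :=
  indicator_of_notMem (not_le.2 hs) _

theorem integrableOn_inv_add_mul_norm_rho {a : ℝ} (ha : 0 < a) :
    IntegrableOn (fun t => (a + t)⁻¹ * ‖(rho t : ℂ)‖) (Ioi 0) := by
  obtain ⟨C, -, hrho⟩ := exists_norm_rho_le
  refine ((integrableOn_powerWeight_div_add (α := 1 / 4) (β := 3 / 4) (by norm_num) (by norm_num)
    ha).const_mul C).mono' ?_ ?_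
  · have := measurable_rho
    fun_prop
  · filter_upwards [ae_restrict_mem measurableSet_Ioi] with t ht
    have hat : 0 < a + t := add_pos ha ht
    rw [norm_mul, norm_norm, norm_inv, Real.norm_of_nonneg hat.le, mul_div_assoc', div_eq_inv_mul]
    gcongr
    exact hrho t ht

theorem one_sub_G_eq_integral {z : ℂ} (hz : 0 < z.re) :
    1 - G z = ∫ t in Ioi (0 : ℝ), (z + t)⁻¹ • (rho t : ℂ) := by
  have him {t : ℝ} (ht : 0 < t) : (1 - G (-t)).im = -(Real.pi * rho t) := by
    simp [im_G_neg ht]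
  have hint : IntegrableOn (fun t : ℝ => (z + t)⁻¹ • (rho t : ℂ)) (Ioi 0) := by
    refine (integrableOn_inv_add_mul_norm_rho hz).mono' ?_ ?_
    · have := measurable_rho
      fun_prop
    · filter_upwards [ae_restrict_mem measurableSet_Ioi] with t ht
      rw [norm_smul, norm_inv]
      have hzt : 0 < z.re + t := add_pos hz ht
      gcongr
      simpa using Complex.re_le_norm (z + t)
  have hcongr : EqOn (fun t : ℝ => ((1 - G (-t)).im : ℂ) / (z + t))
      (fun t => -Real.pi * ((z + t)⁻¹ • (rho t : ℂ))) (Ioi 0) := fun t ht => by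
    simp only [him ht, smul_eq_mul]
    push_cast
    ring
  rw [eq_integral_im_neg_div_add (F := fun z => 1 - G z) (continuousOn_const.sub continuousOn_G)
    (fun w hw => ((differentiableAt_G hw).const_sub 1).differentiableWithinAt)
    (fun w hw => by simp [G_conj hw])
    (tendsto_mul_one_sub_G_zero.mono_left (nhdsWithin_mono _ fun w hw => hw.2))
    tendsto_one_sub_G_cobounded (.inl hz)
    (IntegrableOn.congr_fun (hint.const_mul _) hcongr.symm measurableSet_Ioi),
    setIntegral_congr_fun measurableSet_Ioi hcongr, integral_const_mul]
  field_simp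

theorem laplace_phiPos {z : ℂ} (hz : 0 < z.re) : laplace phiPos z = 1 - G z := by
  rw [one_sub_G_eq_integral hz, ← laplace_laplace (f := fun t => (rho t : ℂ))
    (Complex.measurable_ofReal.comp measurable_rho).aestronglyMeasurable hz
    (integrableOn_inv_add_mul_norm_rho hz)]
  refine setIntegral_congr_fun measurableSet_Ioi fun s hs => ?_
  simp only [phiPos, indicator_of_mem (Ioi_subset_Ici_self hs), phi_eq_laplace]

theorem ae_tendsto_one_sub_G_vertical :
    ∀ᵐ t : ℝ, Tendsto (fun a : ℝ => 1 - G (a + Complex.I * t)) (𝓝[>] 0)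
      (𝓝 (1 - G (Complex.I * t))) := by
  filter_upwards [Measure.ae_ne volume 0] with t ht
  have hG : ContinuousAt G (((0 : ℝ) : ℂ) + Complex.I * t) :=
    (differentiableAt_G (.inr (by simpa using ht))).continuousAt
  have hline : ContinuousAt (fun a : ℝ => (a : ℂ) + Complex.I * t) 0 := by fun_prop
  have hcomp := ContinuousAt.comp (f := fun a : ℝ => (a : ℂ) + Complex.I * t) hG hline
  simpa using (tendsto_const_nhds.sub hcomp.tendsto).mono_left nhdsWithin_le_nhds

theorem integral_norm_sq_phiPos : ∫ s, ‖phiPos s‖ ^ 2 = ∫ s in Ioi (0 : ℝ), phi s ^ 2 := by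
  rw [← integral_Ici_eq_integral_Ioi, ← integral_indicator measurableSet_Ici]
  congr with s
  by_cases hs : s ∈ Ici (0 : ℝ) <;> simp [phiPos, hs]

theorem fourierL2_ae_eq {f : Lp ℂ 2 (volume : Measure ℝ)} {g : ℝ → ℂ}
    (h : (𝓕 f : Lp ℂ 2 (volume : Measure ℝ)) =ᵐ[volume] fun ξ => g (2 * Real.pi * ξ)) :
    fourierL2 f =ᵐ[volume] g := by
  have hquot : Measure.QuasiMeasurePreserving (fun t : ℝ => t / (2 * Real.pi)) := by
    simp only [div_eq_inv_mul]
    exact Measure.quasiMeasurePreserving_smul volume (inv_ne_zero Real.two_pi_pos.ne')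
  filter_upwards [hquot.ae h] with t ht
  rw [fourierL2, ht, mul_div_cancel₀ _ Real.two_pi_pos.ne']

end Density

end CutPlane

end

theorem mainTheorem4 :
    -- `φ` is square integrable on `[0, ∞)`
    MemLp CutPlane.phi 2 (volume.restrict (Ici (0 : ℝ))) ∧
    -- `1 - G` is square integrable on every vertical line `Re z = a`, `a ≥ 0`
    (∀ a : ℝ, 0 ≤ a →
      MemLp (fun t : ℝ => 1 - CutPlane.G ((a : ℂ) + Complex.I * (t : ℂ))) 2 volume) ∧
    -- the limit of the integrals as `a → 0+`
    Tendsto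
      (fun a : ℝ =>
        ∫ t : ℝ, ‖1 - CutPlane.G ((a : ℂ) + Complex.I * (t : ℂ))‖ ^ 2 / (2 * Real.pi))
      (𝓝[>] (0 : ℝ))
      (𝓝 (∫ t : ℝ, ‖1 - CutPlane.G (Complex.I * (t : ℂ))‖ ^ 2 / (2 * Real.pi))) ∧
    -- Plancherel's identity on the imaginary axis
    (∫ t : ℝ, ‖1 - CutPlane.G (Complex.I * (t : ℂ))‖ ^ 2 / (2 * Real.pi)) =
      ∫ s in Ioi (0 : ℝ), CutPlane.phi s ^ 2 ∧
    -- `1 - G(it)` is the `L²`-Fourier transform of `φ · 1_{[0,∞)}`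
    ∃ h : MemLp CutPlane.phiPos 2 (volume : Measure ℝ),
      CutPlane.fourierL2 (h.toLp CutPlane.phiPos) =ᵐ[volume]
        fun t : ℝ => 1 - CutPlane.G (Complex.I * (t : ℂ)) := by
  have hf := CutPlane.memLp_phiPos
  have hsupp : ∀ s < 0, CutPlane.phiPos s = 0 := fun s hs => CutPlane.phiPos_of_neg hs
  have hF : ∀ z : ℂ, 0 < z.re → CutPlane.laplace CutPlane.phiPos z = 1 - CutPlane.G z :=
    fun z hz => CutPlane.laplace_phiPos hz
  have hlim := CutPlane.ae_tendsto_one_sub_G_vertical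
  exact ⟨CutPlane.memLp_phi,
    fun a ha => CutPlane.memLp_vertical hf hsupp hF hlim ha,
    CutPlane.tendsto_integral_norm_sq_vertical (F := fun z => 1 - CutPlane.G z) hf hsupp hF hlim,
    (CutPlane.integral_norm_sq_imaginary_axis hf hsupp hF hlim).trans
      CutPlane.integral_norm_sq_phiPos,
    hf,
    CutPlane.fourierL2_ae_eq (CutPlane.fourier_toLp_ae_eq_of_tendsto_laplace hf hsupp hF hlim)⟩
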